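/- Let $N\ge 2$, $w_0>0$, $\mu_r\in\mathbb R$ and $\sigma_r>0$. Let the returns $r_{i,t}$ ($1\le i\le N$, $t\ge 1$) be independent and identically distributed, with the normal law $N(\mu_r,\sigma_r)$ (mean $\mu_r$, standard deviation $\sigma_r$) restricted to $r\ge -1$, i.e. conditioned on $[-1,\infty)$. All households start with the same wealth $w_0$, and $W_{i,t}=w_0\prod_{s=1}^t(1+r_{i,s})$ is the wealth of household $i$ after $t$ periods of compound returns. For a vector $x=(x_1,\dots,x_N)$ with non-negative entries, not all zero, and increasing rearrangement $x_{(1)}\le\dots\le x_{(N)}$, the Gini index is $$G(x)=\frac{1}{N-1}\left[(N+1)-2\,\frac{\sum_{k=1}^N (N+1-k)\,x_{(k)}}{\sum_{k=1}^N x_{(k)}}\right].$$ Let $\theta_{i,t}=W_{i,t}/\sum_j W_{j,t}$ be the share of household $i$ in total wealth, let $\theta_{(1),t}\le\dots\le\theta_{(N),t}$ be the ranked shares, and let $\bar\theta_{k,T}=\frac1T\sum_{t=1}^T\theta_{(k),t}$ be the time-averaged share of the $k$-th poorest household. Then, almost surely, as $T\to\infty$, $$G(\bar\theta_{1,T},\dots,\bar\theta_{N,T})\to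 1,\qquad \frac1T\sum_{t=1}^T G(W_{1,t},\dots,W_{N,t})\to 1,\qquad \frac1T\sum_{t=1}^T\max_i\theta_{i,t}\to 1 .$$ That is, the Gini index based upon time-averaged (ranked) wealth shares, equivalently the time-averaged Gini index, tends to its maximum value $1$, and the time-averaged share of total wealth held by the wealthiest household tends to $1$. -/

import Mathlib

open MeasureTheory ProbabilityTheory Filter Topology
open scoped NNReal

noncomputable section

namespace CompoundWealth

/-- The law of one return: the normal law with mean `μ` and standard deviation `σ`, subject to
the standing restriction of the model that returns satisfy `r ≥ -1`
(a household cannot lose more than its wealth), i.e. conditioned on `[-1, ∞)`. -/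
def returnLaw (μ : ℝ) (σ : ℝ≥0) : Measure ℝ :=
  ProbabilityTheory.cond (gaussianReal μ (σ ^ 2)) (Set.Ici (-1))

/-- Wealth after `t` periods of compound returns `r 1, r 2, …` from the initial wealth `w₀`. -/
def wealth (w₀ : ℝ) (r : ℕ → ℝ) (t : ℕ) : ℝ :=
  w₀ * ∏ s ∈ Finset.Icc 1 t, (1 + r s)

/-- The entries of `x`, ranked in increasing order. -/
def ranked {N : ℕ} (x : Fin N → ℝ) (k : Fin N) : ℝ :=
  x (Tuple.sort x k)

/-- The Gini index
`[(N + 1) - 2 (∑ₖ (N + 1 - k) wₖ) / (∑ₖ wₖ)] / (N - 1)`, where `w₁ ≤ … ≤ w_N` are the ranked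
entries of `x`; the index `k : Fin N` starts at `0`, so the weight `N + 1 - k` reads `N - k`. -/
def gini {N : ℕ} (x : Fin N → ℝ) : ℝ :=
  (((N : ℝ) + 1) -
      2 * ((∑ k : Fin N, ((N : ℝ) - (k : ℕ)) * ranked x k) / ∑ k : Fin N, ranked x k)) *
    (1 / ((N : ℝ) - 1))

/-- The share of household `i` in total wealth, for the wealth distribution `x`. -/
def share {N : ℕ} (x : Fin N → ℝ) (i : Fin N) : ℝ :=
  x i / ∑ j, x j

/-- The average of `f` over the periods `1, …, T`. -/
def timeAverage (f : ℕ → ℝ) (T : ℕ) : ℝ :=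
  (∑ t ∈ Finset.Icc 1 T, f t) / T

end CompoundWealth

end

namespace CompoundWealth

/-! ### Time averages -/

/-! The log-wealth gap `S_t` between two households is a random walk whose steps are differences of
two independent copies of `log (1 + r)`, and these steps are not degenerate. Such a walk spreads
out, so the two wealths are rarely comparable.

Quantitatively, the step has characteristic function `|charFun ν|²`, at most `1 - c u²` near `0`.
Smoothing with a Gaussian and applying Parseval gives `E exp(-|S_t|) = O(t^(-1/4))`
(`exists_integral_exp_neg_abs_le`); no moments are needed. Hence `∑ E exp(-|S_t|) / t` is finite,
and Kronecker's lemma makes the time averages of `exp(-|S_t|)` vanish almost surely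
(`ae_tendsto_timeAverage_zero`).

The rest is deterministic (`tendsto_gini_of_gaps`): the largest share is at least `1` minus the sum
of `exp(-|gap|)` over ordered pairs, and the Gini index lies between `1 - 2 (1 - largest share)` and
`1`. -/

lemma timeAverage_mono {f g : ℕ → ℝ} (h : ∀ t, f t ≤ g t) (T : ℕ) :
    timeAverage f T ≤ timeAverage g T := by
  unfold timeAverage
  gcongr
  exact h _

lemma timeAverage_const (c : ℝ) {T : ℕ} (hT : T ≠ 0) : timeAverage (fun _ => c) T = c := by
  unfold timeAverage
  have : (T : ℝ) ≠ 0 := Nat.cast_ne_zero.mpr hT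
  simp only [Finset.sum_const, Nat.card_Icc, Nat.add_sub_cancel, nsmul_eq_mul]
  field_simp

lemma timeAverage_sub (f g : ℕ → ℝ) (T : ℕ) :
    timeAverage (fun t => f t - g t) T = timeAverage f T - timeAverage g T := by
  simp only [timeAverage, Finset.sum_sub_distrib, sub_div]

lemma timeAverage_const_mul (c : ℝ) (f : ℕ → ℝ) (T : ℕ) :
    timeAverage (fun t => c * f t) T = c * timeAverage f T := by
  simp only [timeAverage, ← Finset.mul_sum, mul_div_assoc]

lemma timeAverage_sum {ι : Type*} (s : Finset ι) (f : ι → ℕ → ℝ) (T : ℕ) :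
    timeAverage (fun t => ∑ i ∈ s, f i t) T = ∑ i ∈ s, timeAverage (f i) T := by
  simp only [timeAverage, ← Finset.sum_div]
  rw [Finset.sum_comm]

/-- A sequence bounded above by `1` whose defect is dominated by a sequence with vanishing time
average has time averages tending to `1`. -/
lemma tendsto_timeAverage_one {a b : ℕ → ℝ} (h1 : ∀ t, a t ≤ 1) (h2 : ∀ t, 1 - b t ≤ a t)
    (hb : Tendsto (timeAverage b) atTop (𝓝 0)) : Tendsto (timeAverage a) atTop (𝓝 1) := by
  have hb' : Tendsto (fun T => 1 - timeAverage b T) atTop (𝓝 1) := by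
    simpa using hb.const_sub 1
  refine tendsto_of_tendsto_of_tendsto_of_le_of_le' hb' tendsto_const_nhds ?_ ?_
  · filter_upwards [eventually_ne_atTop 0] with T hT
    have := timeAverage_mono h2 T
    rwa [timeAverage_sub, timeAverage_const 1 hT] at this
  · filter_upwards [eventually_ne_atTop 0] with T hT
    have := timeAverage_mono h1 T
    rwa [timeAverage_const 1 hT] at this

/-- Kronecker's lemma for non-negative sequences. -/
lemma tendsto_timeAverage_zero_of_summable {a : ℕ → ℝ} (ha : ∀ t, 0 ≤ a t)
    (hs : Summable fun t : ℕ => a t / t) : Tendsto (timeAverage a) atTop (𝓝 0) := by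
  -- For fixed `t` the term `a t / T` tends to `0`, and for `t ≤ T` it is at most `a t / t`:
  -- dominated convergence for series applies.
  have key : Tendsto (fun T : ℕ => ∑' t, if t ∈ Finset.Icc 1 T then a t / T else 0) atTop
      (𝓝 (∑' _ : ℕ, (0 : ℝ))) := by
    refine tendsto_tsum_of_dominated_convergence hs (fun t => ?_) (Eventually.of_forall ?_)
    · refine squeeze_zero (g := fun T : ℕ => a t / T) (fun T => ?_) (fun T => ?_)
        (tendsto_const_div_atTop_nhds_zero_nat _)
      · split_ifs
        · exact div_nonneg (ha t) T.cast_nonneg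
        · exact le_rfl
      · split_ifs
        · exact le_rfl
        · exact div_nonneg (ha t) T.cast_nonneg
    · intro T t
      split_ifs with h
      · rw [Finset.mem_Icc] at h
        have h1 : (0 : ℝ) < t := by exact_mod_cast h.1
        have h2 : (t : ℝ) ≤ T := by exact_mod_cast h.2
        rw [Real.norm_of_nonneg (div_nonneg (ha t) T.cast_nonneg)]
        exact div_le_div_of_nonneg_left (ha t) h1 h2
      · rw [norm_zero]
        exact div_nonneg (ha t) t.cast_nonneg
  rw [tsum_zero] at key
  refine key.congr fun T => ?_
  rw [tsum_eq_sum (s := Finset.Icc 1 T) (fun t ht => if_neg ht), timeAverage, Finset.sum_div]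
  exact Finset.sum_congr rfl fun t ht => if_pos ht

/-! ### Ranked vectors, shares and the Gini index -/

lemma sum_ranked {N : ℕ} (x : Fin N → ℝ) : ∑ k, ranked x k = ∑ i, x i :=
  Equiv.sum_comp (Tuple.sort x) x

lemma ranked_mono {N : ℕ} (x : Fin N → ℝ) : Monotone (ranked x) :=
  Tuple.monotone_sort x

lemma le_ranked_last {N : ℕ} (x : Fin N → ℝ) {l : Fin N} (hl : ∀ k, k ≤ l) (i : Fin N) :
    x i ≤ ranked x l := by
  have := ranked_mono x (hl ((Tuple.sort x).symm i))
  simpa [ranked] using this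

lemma ranked_last {N : ℕ} [Nonempty (Fin N)] (x : Fin N → ℝ) {l : Fin N} (hl : ∀ k, k ≤ l) :
    ranked x l = ⨆ i, x i :=
  le_antisymm (le_ciSup (Set.finite_range x).bddAbove (Tuple.sort x l))
    (ciSup_le (le_ranked_last x hl))

/-- The weights `N - k` are all at least `1`, which gives the upper bound. They are at most `N`, and
equal `1` on the largest entry, which dominates `x i`; this gives the lower bound. -/
lemma gini_bounds {N : ℕ} (hN : 2 ≤ N) {x : Fin N → ℝ} (hx : ∀ i, 0 ≤ x i)
    (hS : 0 < ∑ i, x i) (i : Fin N) :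
    gini x ≤ 1 ∧ 1 - 2 * (1 - x i / ∑ j, x j) ≤ gini x := by
  have hN' : (2 : ℝ) ≤ N := by exact_mod_cast hN
  have hR : ∀ k, 0 ≤ ranked x k := fun k => hx _
  let l : Fin N := ⟨N - 1, by omega⟩
  have hl : ∀ k, k ≤ l := fun k => Fin.le_def.mpr (by have := k.2; simp only [l]; omega)
  have hlc : ((l : ℕ) : ℝ) = N - 1 := by
    simp only [l]
    rw [Nat.cast_sub (by omega), Nat.cast_one]
  set A := ∑ k : Fin N, ((N : ℝ) - (k : ℕ)) * ranked x k with hA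
  set S := ∑ j, x j with hSdef
  have hlow : S ≤ A := by
    rw [hSdef, ← sum_ranked, hA]
    refine Finset.sum_le_sum fun k _ => ?_
    have : ((k : ℕ) : ℝ) + 1 ≤ N := by exact_mod_cast k.2
    nlinarith [hR k]
  have hupp : A ≤ N * S - (N - 1) * x i := by
    have h1 : A ≤ ∑ k, ((N : ℝ) * ranked x k - if k = l then ((N : ℝ) - 1) * ranked x k else 0) := by
      refine Finset.sum_le_sum fun k _ => ?_
      split_ifs with h
      · rw [h, hlc]
        linarith
      · have : (0 : ℝ) ≤ (k : ℕ) := Nat.cast_nonneg _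
        nlinarith [hR k]
    rw [Finset.sum_sub_distrib, ← Finset.mul_sum, sum_ranked, Finset.sum_ite_eq' Finset.univ l] at h1
    simp only [Finset.mem_univ, if_true] at h1
    nlinarith [le_ranked_last x hl i]
  have hg : gini x = 1 - 2 * (A / S - 1) / (N - 1) := by
    unfold gini
    rw [sum_ranked, ← hA, ← hSdef]
    have : (N : ℝ) - 1 ≠ 0 := by linarith
    field_simp
    ring
  have hN1 : (0 : ℝ) < N - 1 := by linarith
  rw [hg]
  constructor
  · have : 0 ≤ 2 * (A / S - 1) / ((N : ℝ) - 1) := by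
      have : 1 ≤ A / S := (one_le_div hS).mpr hlow
      apply div_nonneg _ hN1.le
      linarith
    linarith
  · have : 2 * (A / S - 1) / ((N : ℝ) - 1) ≤ 2 * (1 - x i / S) := by
      rw [div_le_iff₀ hN1]
      have : A / S ≤ N - (N - 1) * (x i / S) := by
        rw [div_le_iff₀ hS]
        have : (N - (N - 1) * (x i / S)) * S = N * S - (N - 1) * x i := by
          field_simp
        linarith
      nlinarith
    linarith

lemma sum_share {N : ℕ} {x : Fin N → ℝ} (hS : 0 < ∑ i, x i) : ∑ i, share x i = 1 := by
  simp only [share, ← Finset.sum_div]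
  exact div_self hS.ne'

/-- The largest share is close to `1` as soon as no two entries are comparable in size. -/
lemma one_sub_iSup_share_le {N : ℕ} [Nonempty (Fin N)] {x : Fin N → ℝ} (hx : ∀ i, 0 < x i) :
    1 - ∑ p ∈ (Finset.univ : Finset (Fin N)).offDiag,
      Real.exp (-|Real.log (x p.1) - Real.log (x p.2)|) ≤ ⨆ i, share x i := by
  obtain ⟨i, hi⟩ := Finite.exists_max x
  have hS : 0 < ∑ i, x i := Finset.sum_pos (fun i _ => hx i) Finset.univ_nonempty
  refine le_trans ?_ (le_ciSup (Set.finite_range (share x)).bddAbove i)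
  have h1 : 1 - share x i = ∑ j ∈ Finset.univ.erase i, share x j := by
    rw [← sum_share hS, ← Finset.add_sum_erase _ _ (Finset.mem_univ i)]
    ring
  -- As `x i` is maximal and at most the total, the share of `j` is at most `x j / x i =
  -- exp(-|gap|)`.
  have h2 : ∑ j ∈ Finset.univ.erase i, share x j ≤
      ∑ j ∈ Finset.univ.erase i, Real.exp (-|Real.log (x i) - Real.log (x j)|) := by
    refine Finset.sum_le_sum fun j _ => ?_
    rw [abs_of_nonneg (sub_nonneg.mpr (Real.log_le_log (hx j) (hi j))), neg_sub, Real.exp_sub,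
      Real.exp_log (hx i), Real.exp_log (hx j)]
    exact div_le_div_of_nonneg_left (hx j).le (hx i)
      (Finset.single_le_sum (fun k _ => (hx k).le) (Finset.mem_univ i))
  have h3 : ∑ j ∈ Finset.univ.erase i, Real.exp (-|Real.log (x i) - Real.log (x j)|) ≤
      ∑ p ∈ (Finset.univ : Finset (Fin N)).offDiag,
        Real.exp (-|Real.log (x p.1) - Real.log (x p.2)|) := by
    rw [← Finset.sum_image (s := Finset.univ.erase i) (g := fun j => (i, j))
      (f := fun p : Fin N × Fin N => Real.exp (-|Real.log (x p.1) - Real.log (x p.2)|))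
      (fun a _ b _ h => (Prod.mk.inj h).2)]
    refine Finset.sum_le_sum_of_subset_of_nonneg ?_ fun _ _ _ => (Real.exp_pos _).le
    intro p hp
    obtain ⟨j, hj, rfl⟩ := Finset.mem_image.mp hp
    exact Finset.mem_offDiag.mpr ⟨Finset.mem_univ _, Finset.mem_univ _,
      (Finset.ne_of_mem_erase hj).symm⟩
  linarith

/-- If the logarithmic wealth gaps between any two households are large most of the time, then
wealth condenses in the time average. -/
theorem tendsto_gini_of_gaps {N : ℕ} (hN : 2 ≤ N) {x : ℕ → Fin N → ℝ} (hx : ∀ t i, 0 < x t i)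
    (hgap : ∀ i j, i ≠ j → Tendsto (timeAverage fun t =>
      Real.exp (-|Real.log (x t i) - Real.log (x t j)|)) atTop (𝓝 0)) :
    Tendsto (fun T : ℕ => gini fun k : Fin N =>
        timeAverage (fun t => ranked (share (x t)) k) T) atTop (𝓝 1) ∧
      Tendsto (timeAverage fun t => gini (x t)) atTop (𝓝 1) ∧
      Tendsto (timeAverage fun t => ⨆ i, share (x t) i) atTop (𝓝 1) := by
  have : Nonempty (Fin N) := ⟨⟨0, by omega⟩⟩
  have hS : ∀ t, 0 < ∑ i, x t i :=
    fun t => Finset.sum_pos (fun i _ => hx t i) Finset.univ_nonempty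
  have hshare : ∀ t i, 0 ≤ share (x t) i := fun t i => div_nonneg (hx t i).le (hS t).le
  have hshare1 : ∀ t i, share (x t) i ≤ 1 := fun t i => by
    rw [← sum_share (hS t)]
    exact Finset.single_le_sum (fun k _ => hshare t k) (Finset.mem_univ i)
  have hsum : Tendsto (timeAverage fun t => ∑ p ∈ (Finset.univ : Finset (Fin N)).offDiag,
      Real.exp (-|Real.log (x t p.1) - Real.log (x t p.2)|)) atTop (𝓝 0) := by
    have := tendsto_finsetSum (Finset.univ : Finset (Fin N)).offDiag
      fun p hp => hgap p.1 p.2 (Finset.mem_offDiag.mp hp).2.2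
    rw [Finset.sum_const_zero] at this
    exact this.congr fun T => (timeAverage_sum _ _ T).symm
  have hmax : Tendsto (timeAverage fun t => ⨆ i, share (x t) i) atTop (𝓝 1) :=
    tendsto_timeAverage_one (fun t => ciSup_le (hshare1 t))
      (fun t => one_sub_iSup_share_le (hx t)) hsum
  refine ⟨?_, ?_, hmax⟩
  · let l : Fin N := ⟨N - 1, by omega⟩
    have hl : ∀ k, k ≤ l := fun k => Fin.le_def.mpr (by have := k.2; simp only [l]; omega)
    have hy : ∀ T ≠ 0, ∑ k, timeAverage (fun t => ranked (share (x t)) k) T = 1 := by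
      intro T hT
      rw [← timeAverage_sum]
      simp only [sum_ranked, sum_share (hS _)]
      exact timeAverage_const 1 hT
    -- The averaged ranked shares sum to `1`, and the one at `l` is the averaged largest share.
    have hb : ∀ T ≠ 0, _ := fun T hT => gini_bounds hN
      (x := fun k => timeAverage (fun t => ranked (share (x t)) k) T)
      (fun k => div_nonneg (Finset.sum_nonneg fun t _ => hshare t _) T.cast_nonneg)
      (by rw [hy T hT]; exact one_pos) l
    have hlow : Tendsto (fun T => 1 - 2 * (1 - timeAverage (fun t => ⨆ i, share (x t) i) T))
        atTop (𝓝 1) := by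
      simpa using ((hmax.const_sub 1).const_mul 2).const_sub 1
    refine tendsto_of_tendsto_of_tendsto_of_le_of_le' hlow tendsto_const_nhds ?_ ?_
    · filter_upwards [eventually_ne_atTop 0] with T hT
      have := (hb T hT).2
      rw [hy T hT, div_one] at this
      simpa only [ranked_last _ hl] using this
    · filter_upwards [eventually_ne_atTop 0] with T hT using (hb T hT).1
  · refine tendsto_timeAverage_one
      (b := fun t => 2 * ∑ p ∈ (Finset.univ : Finset (Fin N)).offDiag,
        Real.exp (-|Real.log (x t p.1) - Real.log (x t p.2)|))
      (fun t => (gini_bounds hN (fun i => (hx t i).le) (hS t) ⟨0, by omega⟩).1) (fun t => ?_) ?_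
    · obtain ⟨i, hi⟩ := exists_eq_ciSup_of_finite (f := share (x t))
      have h1 := (gini_bounds hN (fun i => (hx t i).le) (hS t) i).2
      have h2 := one_sub_iSup_share_le (hx t)
      rw [← hi, share] at h2
      linarith
    · simpa only [mul_zero] using
        (hsum.const_mul 2).congr fun T => (timeAverage_const_mul 2 _ T).symm

/-! ### Characteristic functions and concentration -/

/-- The characteristic function of a non-degenerate law decays at least quadratically at `0`. -/
lemma exists_re_charFun_le (ρ : Measure ℝ) [IsProbabilityMeasure ρ] (hρ : ¬ ∀ᵐ z ∂ρ, z = 0) :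
    ∃ c > 0, ∃ ε > 0, ∀ u : ℝ, |u| ≤ ε → (charFun ρ u).re ≤ 1 - c * u ^ 2 := by
  -- Truncating to a bounded window avoids assuming a second moment.
  have hint : ∀ n : ℕ, Integrable ((Set.Icc (-(n : ℝ)) n).indicator fun z => z ^ 2) ρ := fun n =>
    ((continuous_pow 2).continuousOn.integrableOn_Icc).integrable_indicator measurableSet_Icc
  have hnn : ∀ n : ℕ, 0 ≤ (Set.Icc (-(n : ℝ)) n).indicator fun z : ℝ => z ^ 2 :=
    fun n => Set.indicator_nonneg fun z _ => sq_nonneg z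
  obtain ⟨n, hn⟩ : ∃ n : ℕ, 0 < ∫ z, (Set.Icc (-(n : ℝ)) n).indicator (fun z => z ^ 2) z ∂ρ := by
    by_contra! h
    refine hρ ?_
    have hz : ∀ n : ℕ, (Set.Icc (-(n : ℝ)) n).indicator (fun z : ℝ => z ^ 2) =ᵐ[ρ] 0 := fun n =>
      (integral_eq_zero_iff_of_nonneg (hnn n) (hint n)).mp
        (le_antisymm (h n) (integral_nonneg (hnn n)))
    filter_upwards [ae_all_iff.mpr hz] with z hz
    obtain ⟨m, hm⟩ := exists_nat_ge |z|
    have := hz m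
    rw [Set.indicator_of_mem (Set.mem_Icc.mpr (abs_le.mp hm))] at this
    simpa using this
  set V := ∫ z, (Set.Icc (-(n : ℝ)) n).indicator (fun z => z ^ 2) z ∂ρ with hV
  -- From `cos y ≤ 1 - (2 / π²) y²` for `|y| ≤ π`; the choice of `ε` keeps `|u z| ≤ 1` on the
  -- window.
  refine ⟨2 / Real.pi ^ 2 * V, by positivity, 1 / (n + 1), by positivity, fun u hu => ?_⟩
  have hexp : Integrable (fun z : ℝ => Complex.exp (u * z * Complex.I)) ρ := by
    refine Integrable.of_bound (C := 1) (by fun_prop) (Eventually.of_forall fun z => ?_)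
    rw [← Complex.ofReal_mul, Complex.norm_exp_ofReal_mul_I]
  have hre : (charFun ρ u).re = ∫ z, Real.cos (u * z) ∂ρ := by
    rw [charFun_apply_real]
    have := integral_re hexp
    simp only [RCLike.re_eq_complex_re] at this
    rw [← this]
    refine integral_congr_ae (Eventually.of_forall fun z => ?_)
    simp only
    rw [← Complex.ofReal_mul, Complex.exp_ofReal_mul_I_re]
  rw [hre]
  calc ∫ z, Real.cos (u * z) ∂ρ
      ≤ ∫ z, (1 - 2 / Real.pi ^ 2 * u ^ 2 *
          (Set.Icc (-(n : ℝ)) n).indicator (fun z => z ^ 2) z) ∂ρ := by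
        refine integral_mono ?_ ((integrable_const _).sub ((hint n).const_mul _)) fun z => ?_
        · refine Integrable.of_bound (C := 1) (by fun_prop) (Eventually.of_forall fun z => ?_)
          exact Real.abs_cos_le_one _
        · by_cases hz : z ∈ Set.Icc (-(n : ℝ)) n
          · simp only [Set.indicator_of_mem hz]
            have h1 : |u * z| ≤ 1 := by
              rw [abs_mul]
              have hz' : |z| ≤ n + 1 := (abs_le.mpr hz).trans (by linarith)
              calc |u| * |z| ≤ 1 / (n + 1) * (n + 1) := by gcongr
                _ = 1 := by field_simp
            refine (Real.cos_le_one_sub_mul_cos_sq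
              (h1.trans (by linarith [Real.pi_gt_three]))).trans (le_of_eq ?_)
            ring
          · simp only [Set.indicator_of_notMem hz, mul_zero, sub_zero]
            exact Real.cos_le_one _
    _ = 1 - 2 / Real.pi ^ 2 * V * u ^ 2 := by
        rw [integral_sub (integrable_const _) ((hint n).const_mul _), integral_const_mul, ← hV]
        simp only [integral_const, probReal_univ, smul_eq_mul]
        ring

/-- The characteristic function of the difference of two independent copies is `‖charFun ν‖²`;
for an atomless `ν` it decays at least quadratically at `0`. -/
lemma exists_norm_charFun_mul_neg_le (ν : Measure ℝ) [IsProbabilityMeasure ν]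
    [NullSingletonClass ν] :
    ∃ c > 0, ∃ ε > 0, ∀ u : ℝ, |u| ≤ ε → ‖charFun ν u * charFun ν (-u)‖ ≤ 1 - c * u ^ 2 := by
  have hp : IsProbabilityMeasure (ν.map ((-1 : ℝ) * ·)) :=
    Measure.isProbabilityMeasure_map (by fun_prop)
  obtain ⟨c, hc, ε, hε, h⟩ := exists_re_charFun_le (ν ∗ ν.map ((-1 : ℝ) * ·)) (by
    intro h
    rw [Measure.conv, ae_map_iff (p := fun z : ℝ => z = 0) (by fun_prop)
      (measurableSet_eq_fun measurable_id measurable_const)] at h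
    have h2 := Measure.ae_ae_of_ae_prod h
    -- Were the difference a.e. zero, Fubini would concentrate `ν` at a single point `x`.
    obtain ⟨x, hx⟩ := h2.exists
    rw [ae_map_iff (by fun_prop) (measurableSet_eq_fun (by fun_prop) (by fun_prop))] at hx
    have h3 : ∀ᵐ y ∂ν, y ≠ x := by
      rw [ae_iff]
      simp
    obtain ⟨y, hy, hy'⟩ := (hx.and h3).exists
    exact hy' (by linarith))
  refine ⟨c, hc, ε, hε, fun u hu => ?_⟩
  have h' := h u hu
  rw [charFun_conv, charFun_map_mul, neg_one_mul] at h'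
  refine le_trans (le_of_eq ?_) h'
  rw [charFun_neg, Complex.mul_conj, Complex.ofReal_re, Complex.norm_real, Real.norm_of_nonneg
    (Complex.normSq_nonneg _)]

/-- Parseval's identity for two finite measures. -/
lemma integral_charFun_comm (m γ : Measure ℝ) [IsFiniteMeasure m] [IsFiniteMeasure γ] :
    ∫ s, charFun γ s ∂m = ∫ u, charFun m u ∂γ := by
  simp only [charFun_apply_real]
  rw [integral_integral_swap]
  · refine integral_congr_ae (Eventually.of_forall fun u => ?_)
    refine integral_congr_ae (Eventually.of_forall fun s => ?_)
    simp only [mul_comm (s : ℂ)]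
  · refine Integrable.of_bound (C := 1) (by fun_prop) (Eventually.of_forall fun p => ?_)
    simp only [Function.uncurry]
    rw [← Complex.ofReal_mul, Complex.norm_exp_ofReal_mul_I]

/-- The Gaussian density is bounded by its peak value. -/
lemma integral_exp_neg_mul_sq_gaussianReal_le {b : ℝ} (hb : 0 < b) {v : ℝ≥0} (hv : v ≠ 0) :
    ∫ u, Real.exp (-b * u ^ 2) ∂(gaussianReal 0 v) ≤
      (√(2 * Real.pi * v))⁻¹ * √(Real.pi / b) := by
  rw [integral_gaussianReal_eq_integral_smul hv, ← integral_gaussian, ← integral_const_mul]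
  refine integral_mono_of_nonneg (Eventually.of_forall fun u => ?_)
    ((integrable_exp_neg_mul_sq hb).const_mul _) (Eventually.of_forall fun u => ?_)
  · exact mul_nonneg (gaussianPDFReal_nonneg _ _ _) (Real.exp_pos _).le
  · simp only [smul_eq_mul]
    refine mul_le_mul_of_nonneg_right ?_ (Real.exp_pos _).le
    rw [gaussianPDFReal]
    refine mul_le_of_le_one_right (by positivity) (Real.exp_le_one_iff.mpr ?_)
    exact div_nonpos_of_nonpos_of_nonneg (neg_nonpos.mpr (sq_nonneg _)) (by positivity)

lemma integral_exp_neg_sq_le {m : Measure ℝ} [IsProbabilityMeasure m] {φ : ℝ → ℂ}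
    {c ε : ℝ} (hc : 0 < c) (hε : 0 < ε) (hφ1 : ∀ u, ‖φ u‖ ≤ 1)
    (hφ : ∀ u, |u| ≤ ε → ‖φ u‖ ≤ 1 - c * u ^ 2) {t : ℕ} (ht : 0 < t)
    (hm : ∀ u, charFun m u = φ u ^ t) {v : ℝ≥0} (hv : v ≠ 0) :
    ∫ s, Real.exp (-(v * s ^ 2 / 2)) ∂m ≤
      (√(2 * Real.pi * v))⁻¹ * √(Real.pi / (c * t)) + v / ε ^ 2 := by
  have hct : 0 < c * t := by positivity
  -- The integrand is the characteristic function of `N(0, v)`, so Parseval moves the integral to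
  -- the frequency side.
  have h1 : ((∫ s, Real.exp (-(v * s ^ 2 / 2)) ∂m : ℝ) : ℂ) =
      ∫ u, charFun m u ∂(gaussianReal 0 v) := by
    rw [← integral_charFun_comm, ← integral_complex_ofReal]
    refine integral_congr_ae (Eventually.of_forall fun s => ?_)
    simp only [charFun_gaussianReal]
    push_cast
    congr 1
    ring
  have h2 : ∫ s, Real.exp (-(v * s ^ 2 / 2)) ∂m ≤ ∫ u, ‖charFun m u‖ ∂(gaussianReal 0 v) := by
    refine le_trans ?_ (norm_integral_le_integral_norm _)
    rw [← h1, Complex.norm_real]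
    exact le_abs_self _
  have hsq : Integrable (fun u : ℝ => u ^ 2) (gaussianReal 0 v) :=
    (memLp_id_gaussianReal 2).integrable_sq
  have hsqv : ∫ u, u ^ 2 ∂(gaussianReal 0 v) = v := by
    have := variance_id_gaussianReal (μ := 0) (v := v)
    rw [variance_of_integral_eq_zero aemeasurable_id (by simp)] at this
    simpa using this
  have hexp : Integrable (fun u : ℝ => Real.exp (-(c * t) * u ^ 2)) (gaussianReal 0 v) := by
    refine Integrable.of_bound (C := 1) (by fun_prop) (Eventually.of_forall fun u => ?_)
    rw [Real.norm_of_nonneg (Real.exp_pos _).le, Real.exp_le_one_iff]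
    nlinarith [sq_nonneg u]
  calc ∫ s, Real.exp (-(v * s ^ 2 / 2)) ∂m
      ≤ ∫ u, ‖charFun m u‖ ∂(gaussianReal 0 v) := h2
    _ ≤ ∫ u, (Real.exp (-(c * t) * u ^ 2) + u ^ 2 / ε ^ 2) ∂(gaussianReal 0 v) := by
        refine integral_mono_of_nonneg (Eventually.of_forall fun u => norm_nonneg _)
          (hexp.add (hsq.div_const _)) (Eventually.of_forall fun u => ?_)
        simp only
        rw [hm, norm_pow]
        -- Low frequencies use the quadratic decay; high ones are paid for by `u² / ε² ≥ 1`, as in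
        -- Chebyshev's inequality.
        rcases le_or_gt |u| ε with hu | hu
        · have : ‖φ u‖ ^ t ≤ Real.exp (-(c * t) * u ^ 2) := by
            calc ‖φ u‖ ^ t ≤ (Real.exp (-(c * u ^ 2))) ^ t := by
                  gcongr
                  linarith [hφ u hu, Real.add_one_le_exp (-(c * u ^ 2))]
              _ = Real.exp (-(c * t) * u ^ 2) := by
                  rw [← Real.exp_nat_mul]
                  congr 1
                  ring
          have h3 : 0 ≤ u ^ 2 / ε ^ 2 := by positivity
          linarith
        · have h3 : 1 ≤ u ^ 2 / ε ^ 2 := by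
            rw [one_le_div (by positivity), ← sq_abs u]
            gcongr
          have := pow_le_one₀ (norm_nonneg (φ u)) (hφ1 u) (n := t)
          linarith [Real.exp_pos (-(c * t) * u ^ 2)]
    _ ≤ _ := by
        rw [integral_add hexp (hsq.div_const _), integral_div, hsqv]
        gcongr
        exact integral_exp_neg_mul_sq_gaussianReal_le hct hv

/-- If `δ |s| ≤ 1`, the Gaussian term is at least `2 (1 - 1/2) = 1`; otherwise `exp(-|s|) ≤ 1 / |s|
≤ δ`. -/
lemma exp_neg_abs_le {δ : ℝ} (hδ : 0 < δ) (s : ℝ) :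
    Real.exp (-|s|) ≤ 2 * Real.exp (-(δ ^ 2 * s ^ 2 / 2)) + δ := by
  have hs : δ ^ 2 * s ^ 2 = (δ * |s|) ^ 2 := by rw [mul_pow, sq_abs]
  rcases le_or_gt (δ * |s|) 1 with h | h
  · have h1 : δ ^ 2 * s ^ 2 ≤ 1 := hs ▸ pow_le_one₀ (by positivity) h
    have h2 : Real.exp (-|s|) ≤ 1 := Real.exp_le_one_iff.mpr (neg_nonpos.mpr (abs_nonneg s))
    linarith [Real.add_one_le_exp (-(δ ^ 2 * s ^ 2 / 2))]
  · have h1 : Real.exp (-|s|) ≤ δ := by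
      rw [Real.exp_neg]
      refine inv_le_of_inv_le₀ hδ ?_
      have : δ⁻¹ ≤ |s| := by
        rw [inv_le_iff_one_le_mul₀ hδ]
        linarith
      linarith [Real.add_one_le_exp |s|]
    linarith [Real.exp_pos (-(δ ^ 2 * s ^ 2 / 2))]

/-- Spreading of a random walk: if the characteristic functions of laws `m t` are the powers of a
function which decays quadratically at `0`, then `m t` charges bounded sets by at most
`O(t ^ (-1/4))`. -/
lemma exists_integral_exp_neg_abs_le {φ : ℝ → ℂ} (hφ1 : ∀ u, ‖φ u‖ ≤ 1)
    (hφ : ∃ c > 0, ∃ ε > 0, ∀ u : ℝ, |u| ≤ ε → ‖φ u‖ ≤ 1 - c * u ^ 2) :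
    ∃ K : ℝ, ∀ (m : Measure ℝ) [IsProbabilityMeasure m] (t : ℕ), 0 < t →
      (∀ u, charFun m u = φ u ^ t) →
      ∫ s, Real.exp (-|s|) ∂m ≤ K * (t : ℝ) ^ (-(1 / 4) : ℝ) := by
  obtain ⟨c, hc, ε, hε, hφ⟩ := hφ
  refine ⟨2 * ((√(2 * Real.pi))⁻¹ * √(Real.pi / c) + 1 / ε ^ 2) + 1, fun m _ t ht hm => ?_⟩
  have ht' : (1 : ℝ) ≤ t := by exact_mod_cast ht
  -- With `v = δ²` the main term is of order `δ⁻¹ t^(-1/2)`; this `δ` balances it against the cutoff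
  -- error `δ`. The term `v / ε²` is smaller still.
  set δ : ℝ := (t : ℝ) ^ (-(1 / 4) : ℝ) with hδ
  have hδ0 : 0 < δ := by positivity
  have hδ1 : δ ≤ 1 := Real.rpow_le_one_of_one_le_of_nonpos ht' (by norm_num)
  have hδ4 : (t : ℝ) = (δ ^ 4)⁻¹ := by
    rw [hδ, ← Real.rpow_natCast, ← Real.rpow_mul (by positivity)]
    norm_num [Real.rpow_neg_one]
  let v : ℝ≥0 := ⟨δ ^ 2, by positivity⟩
  have hv : v ≠ 0 := by
    rw [← NNReal.coe_ne_zero]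
    exact (pow_pos hδ0 2).ne'
  have hvc : (v : ℝ) = δ ^ 2 := rfl
  have h1 := integral_exp_neg_sq_le hc hε hφ1 hφ ht hm hv
  have h2 : (√(2 * Real.pi * v))⁻¹ * √(Real.pi / (c * t)) =
      (√(2 * Real.pi))⁻¹ * √(Real.pi / c) * δ := by
    have e1 : √(2 * Real.pi * v) = √(2 * Real.pi) * δ := by
      rw [hvc, Real.sqrt_mul (by positivity), Real.sqrt_sq hδ0.le]
    have e2 : √(Real.pi / (c * t)) = √(Real.pi / c) * δ ^ 2 := by
      rw [hδ4, show Real.pi / (c * (δ ^ 4)⁻¹) = Real.pi / c * (δ ^ 2) ^ 2 by field_simp,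
        Real.sqrt_mul (by positivity), Real.sqrt_sq (by positivity)]
    rw [e1, e2]
    field_simp
  rw [h2, hvc] at h1
  have hint : Integrable (fun s : ℝ => Real.exp (-(δ ^ 2 * s ^ 2 / 2))) m := by
    refine Integrable.of_bound (C := 1) (by fun_prop) (Eventually.of_forall fun u => ?_)
    rw [Real.norm_of_nonneg (Real.exp_pos _).le, Real.exp_le_one_iff, neg_nonpos]
    positivity
  have h3 : ∫ s, Real.exp (-|s|) ∂m ≤
      2 * ∫ s, Real.exp (-(δ ^ 2 * s ^ 2 / 2)) ∂m + δ := by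
    have := integral_mono_of_nonneg (μ := m) (f := fun s => Real.exp (-|s|))
      (Eventually.of_forall fun s => (Real.exp_pos _).le)
      ((hint.const_mul 2).add (integrable_const δ))
      (Eventually.of_forall fun s => exp_neg_abs_le hδ0 s)
    simp only [Pi.add_apply] at this
    rw [integral_add (hint.const_mul 2) (integrable_const δ), integral_const_mul] at this
    simpa using this
  have h4 : δ ^ 2 / ε ^ 2 ≤ 1 / ε ^ 2 * δ := by
    rw [div_mul_eq_mul_div, one_mul]
    gcongr
    nlinarith
  nlinarith

/-- A sequence of non-negative random variables whose means decay polynomially has vanishing time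
averages almost surely. -/
lemma ae_tendsto_timeAverage_zero {Ω : Type*} [MeasurableSpace Ω] {P : Measure Ω}
    {a : ℕ → Ω → ℝ} (hm : ∀ t, Measurable (a t)) (ha : ∀ t ω, 0 ≤ a t ω)
    (hint : ∀ t, Integrable (a t) P) {K : ℝ}
    (hK : ∀ t : ℕ, 0 < t → ∫ ω, a t ω ∂P ≤ K * (t : ℝ) ^ (-(1 / 4) : ℝ)) :
    ∀ᵐ ω ∂P, Tendsto (timeAverage fun t => a t ω) atTop (𝓝 0) := by
  have hnn : ∀ t ω, 0 ≤ a t ω / t := fun t ω => div_nonneg (ha t ω) t.cast_nonneg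
  have hs : Summable fun t : ℕ => K * (t : ℝ) ^ (-(5 / 4) : ℝ) :=
    (Real.summable_nat_rpow.mpr (by norm_num)).mul_left K
  have hle : ∀ t : ℕ, ∫ ω, a t ω / t ∂P ≤ K * (t : ℝ) ^ (-(5 / 4) : ℝ) := by
    intro t
    rw [integral_div]
    rcases t.eq_zero_or_pos with rfl | ht
    · simp [Real.zero_rpow]
    · have ht' : (0 : ℝ) < t := by exact_mod_cast ht
      rw [div_le_iff₀ ht', mul_assoc, ← Real.rpow_add_one ht'.ne']
      convert! hK t ht using 3
      norm_num
  have hsum : Summable fun t : ℕ => ∫ ω, a t ω / t ∂P :=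
    Summable.of_nonneg_of_le (fun t => integral_nonneg (hnn t)) hle hs
  have hfin : ∫⁻ ω, ∑' t, ENNReal.ofReal (a t ω / t) ∂P ≠ ⊤ := by
    rw [lintegral_tsum fun t => ((hm t).div_const _).ennreal_ofReal.aemeasurable]
    have : ∀ t : ℕ, ∫⁻ ω, ENNReal.ofReal (a t ω / t) ∂P = ENNReal.ofReal (∫ ω, a t ω / t ∂P) :=
      fun t => (ofReal_integral_eq_lintegral_ofReal ((hint t).div_const _)
        (Eventually.of_forall (hnn t))).symm
    simp only [this]
    exact hsum.tsum_ofReal_ne_top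
  filter_upwards [ae_lt_top (Measurable.tsum fun t =>
    ((hm t).div_const _).ennreal_ofReal) hfin] with ω hω
  refine tendsto_timeAverage_zero_of_summable (fun t => ha t ω) ?_
  refine (ENNReal.summable_toReal hω.ne).congr fun t => ?_
  exact ENNReal.toReal_ofReal (hnn t ω)

/-! ### The law of one logarithmic return -/

lemma returnLaw_absolutelyContinuous (μ : ℝ) (σ : ℝ≥0) :
    returnLaw μ σ ≪ gaussianReal μ (σ ^ 2) :=
  cond_absolutelyContinuous

lemma nullSingletonClass_returnLaw (μ : ℝ) {σ : ℝ≥0} (hσ : 0 < σ) :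
    NullSingletonClass (returnLaw μ σ) :=
  have := nullSingletonClass_gaussianReal (μ := μ) (pow_pos hσ 2).ne'
  ⟨fun x => returnLaw_absolutelyContinuous μ σ (measure_singleton x)⟩

lemma ae_returnLaw_gt (μ : ℝ) {σ : ℝ≥0} (hσ : 0 < σ) : ∀ᵐ x ∂(returnLaw μ σ), -1 < x := by
  have := nullSingletonClass_returnLaw μ hσ
  have h1 : ∀ᵐ x ∂(returnLaw μ σ), x ∈ Set.Ici (-1 : ℝ) := ae_cond_mem measurableSet_Ici
  have h2 : ∀ᵐ x ∂(returnLaw μ σ), x ≠ -1 := by simp [ae_iff]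
  filter_upwards [h1, h2] with x hx hx'
  exact lt_of_le_of_ne hx hx'.symm

lemma measurable_log_one_add : Measurable fun x : ℝ => Real.log (1 + x) := by fun_prop

/-- Almost surely `1 + x > 0`, where `log` is injective, so each fibre is a single point up to a
null set. -/
lemma nullSingletonClass_map_log (μ : ℝ) {σ : ℝ≥0} (hσ : 0 < σ) :
    NullSingletonClass ((returnLaw μ σ).map fun x => Real.log (1 + x)) := by
  have := nullSingletonClass_returnLaw μ hσ
  refine ⟨fun y => ?_⟩
  rw [Measure.map_apply measurable_log_one_add (measurableSet_singleton y), measure_eq_zero_iff_ae_notMem]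
  have h2 : ∀ᵐ x ∂(returnLaw μ σ), x ≠ Real.exp y - 1 := by simp [ae_iff]
  filter_upwards [ae_returnLaw_gt μ hσ, h2] with x hx hx' h
  have : Real.log (1 + x) = y := h
  exact hx' (by rw [← this, Real.exp_log (by linarith)]; ring)

lemma wealth_pos {w₀ : ℝ} (hw₀ : 0 < w₀) {r : ℕ → ℝ} (hr : ∀ s, -1 < r s) (t : ℕ) :
    0 < wealth w₀ r t :=
  mul_pos hw₀ (Finset.prod_pos fun s _ => by linarith [hr s])

lemma log_wealth {w₀ : ℝ} (hw₀ : 0 < w₀) {r : ℕ → ℝ} (hr : ∀ s, -1 < r s) (t : ℕ) :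
    Real.log (wealth w₀ r t) = Real.log w₀ + ∑ s ∈ Finset.Icc 1 t, Real.log (1 + r s) := by
  have h : ∀ s, 1 + r s ≠ 0 := fun s => by linarith [hr s]
  rw [wealth, Real.log_mul hw₀.ne' (Finset.prod_ne_zero_iff.mpr fun s _ => h s),
    Real.log_prod fun s _ => h s]

/-- The characteristic function of the difference of two independent random walks. -/
lemma charFun_map_sum_sub_sum {Ω ι : Type*} [MeasurableSpace Ω] {P : Measure Ω}
    [IsProbabilityMeasure P] {X : ι → ℕ → Ω → ℝ} (hX : ∀ i s, Measurable (X i s))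
    (hindep : iIndepFun (fun p : ι × ℕ => X p.1 p.2) P) {ν : Measure ℝ}
    (hν : ∀ i s, P.map (X i s) = ν) {i j : ι} (hij : i ≠ j) (t : ℕ) (u : ℝ) :
    charFun (P.map fun ω => ∑ s ∈ Finset.Icc 1 t, X i s ω - ∑ s ∈ Finset.Icc 1 t, X j s ω) u =
      (charFun ν u * charFun ν (-u)) ^ t := by
  classical
  -- Flipping the sign of every family but `i` writes the difference as one sum of independent terms
  -- over `{i, j} × [1, t]`.
  let f : ι × ℕ → ℝ → ℝ := fun p x => (if p.1 = i then 1 else -1) * x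
  have hf : ∀ p, Measurable (f p) := fun p => measurable_const_mul _
  have hI := hindep.comp f hf
  have hS : (fun ω => ∑ s ∈ Finset.Icc 1 t, X i s ω - ∑ s ∈ Finset.Icc 1 t, X j s ω) =
      fun ω => ∑ p ∈ ({i, j} : Finset ι) ×ˢ Finset.Icc 1 t, (f p ∘ X p.1 p.2) ω := by
    ext ω
    rw [Finset.sum_product, Finset.sum_pair hij]
    simp [f, hij.symm, sub_eq_add_neg]
  have hc : ∀ p : ι × ℕ, charFun (P.map (f p ∘ X p.1 p.2)) u =
      charFun ν ((if p.1 = i then 1 else -1) * u) := by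
    intro p
    rw [← Measure.map_map (hf p) (hX _ _), hν]
    exact charFun_map_mul _ _
  rw [hS, iIndepFun.charFun_map_fun_finsetSum_eq_prod
    (fun p _ => ((hf p).comp (hX _ _)).aemeasurable) (hI.restrict _), Finset.prod_apply,
    Finset.prod_congr rfl fun p _ => hc p, Finset.prod_product, Finset.prod_pair hij]
  simp [hij.symm, mul_pow]

end CompoundWealth

/-! ### Almost sure condensation of wealth -/

theorem lemma1 {Ω : Type*} [MeasurableSpace Ω] (P : Measure Ω) [IsProbabilityMeasure P]
    (N : ℕ) (hN : 2 ≤ N) (w₀ : ℝ) (hw₀ : 0 < w₀) (μ : ℝ) (σ : ℝ≥0) (hσ : 0 < σ)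
    (r : Fin N → ℕ → Ω → ℝ)
    (hmeas : ∀ i t, Measurable (r i t))
    (hlaw : ∀ i t, P.map (r i t) = CompoundWealth.returnLaw μ σ)
    (hindep : iIndepFun (fun p : Fin N × ℕ => r p.1 p.2) P)
    (W : Ω → ℕ → Fin N → ℝ)
    (hW : ∀ ω t i, W ω t i = CompoundWealth.wealth w₀ (fun s => r i s ω) t) :
    ∀ᵐ ω ∂P,
      Tendsto (fun T : ℕ => CompoundWealth.gini (fun k : Fin N =>
          CompoundWealth.timeAverage
            (fun t => CompoundWealth.ranked (CompoundWealth.share (W ω t)) k) T))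
        atTop (𝓝 1) ∧
      Tendsto (CompoundWealth.timeAverage (fun t => CompoundWealth.gini (W ω t)))
        atTop (𝓝 1) ∧
      Tendsto (CompoundWealth.timeAverage (fun t => ⨆ i, CompoundWealth.share (W ω t) i))
        atTop (𝓝 1) := by
  open CompoundWealth in
  have hpos : ∀ᵐ ω ∂P, ∀ i s, -1 < r i s ω := by
    refine ae_all_iff.mpr fun i => ae_all_iff.mpr fun s => ?_
    refine ae_of_ae_map (hmeas i s).aemeasurable ?_
    rw [hlaw]
    exact ae_returnLaw_gt μ hσ
  let X : Fin N → ℕ → Ω → ℝ := fun i s ω => Real.log (1 + r i s ω)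
  have hX : ∀ i s, Measurable (X i s) := fun i s => measurable_log_one_add.comp (hmeas i s)
  have hXI : iIndepFun (fun p : Fin N × ℕ => X p.1 p.2) P :=
    hindep.comp (fun _ x => Real.log (1 + x)) fun _ => measurable_log_one_add
  have hXlaw : ∀ i s, P.map (X i s) = (returnLaw μ σ).map fun x => Real.log (1 + x) := by
    intro i s
    rw [← hlaw i s, Measure.map_map measurable_log_one_add (hmeas i s)]
    rfl
  set ν := (returnLaw μ σ).map fun x => Real.log (1 + x) with hν
  -- Being the law of a random variable under `P`, `ν` has mass `1`; the Gaussian mass of `[-1, ∞)`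
  -- need not be computed.
  have hνp : IsProbabilityMeasure ν := by
    rw [← hXlaw ⟨0, by omega⟩ 0]
    exact Measure.isProbabilityMeasure_map (hX _ _).aemeasurable
  have hνa : NullSingletonClass ν := nullSingletonClass_map_log μ hσ
  obtain ⟨K, hK⟩ := exists_integral_exp_neg_abs_le (φ := fun u => charFun ν u * charFun ν (-u))
    (fun u => by
      rw [norm_mul]
      exact mul_le_one₀ (norm_charFun_le_one _) (norm_nonneg _) (norm_charFun_le_one _))
    (exists_norm_charFun_mul_neg_le ν)
  have hgap : ∀ᵐ ω ∂P, ∀ i j, i ≠ j → Tendsto (timeAverage fun t => Real.exp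
      (-|∑ s ∈ Finset.Icc 1 t, X i s ω - ∑ s ∈ Finset.Icc 1 t, X j s ω|)) atTop (𝓝 0) := by
    refine ae_all_iff.mpr fun i => ae_all_iff.mpr fun j => ?_
    by_cases hij : i = j
    · exact Eventually.of_forall fun ω h => absurd hij h
    have hS : ∀ t, Measurable fun ω =>
        ∑ s ∈ Finset.Icc 1 t, X i s ω - ∑ s ∈ Finset.Icc 1 t, X j s ω := fun t =>
      (Finset.measurable_fun_sum _ fun s _ => hX i s).sub
        (Finset.measurable_fun_sum _ fun s _ => hX j s)
    have hm : ∀ t, Measurable fun ω => Real.exp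
        (-|∑ s ∈ Finset.Icc 1 t, X i s ω - ∑ s ∈ Finset.Icc 1 t, X j s ω|) := fun t =>
      Real.measurable_exp.comp (continuous_abs.measurable.comp (hS t)).neg
    filter_upwards [ae_tendsto_timeAverage_zero (P := P) hm (fun t ω => (Real.exp_pos _).le)
      (fun t => Integrable.of_bound (C := 1) (hm t).aestronglyMeasurable
        (Eventually.of_forall fun ω => by
          rw [Real.norm_of_nonneg (Real.exp_pos _).le, Real.exp_le_one_iff, neg_nonpos]
          exact abs_nonneg _)) (K := K) (fun t ht => by
        have := Measure.isProbabilityMeasure_map (μ := P) (hS t).aemeasurable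
        have h := hK _ t ht (charFun_map_sum_sub_sum hX hXI hXlaw hij t)
        rwa [integral_map (hS t).aemeasurable
          (by fun_prop : Measurable fun s : ℝ => Real.exp (-|s|)).aestronglyMeasurable] at h)]
      with ω hω _ using hω
  filter_upwards [hpos, hgap] with ω hr hg
  refine tendsto_gini_of_gaps hN (fun t i => ?_) fun i j hij => ?_
  · rw [hW]
    exact wealth_pos hw₀ (hr i) t
  -- The common `log w₀` cancels in the gap.
  · simpa only [hW, log_wealth hw₀ (hr _), add_sub_add_left_eq_sub] using hg i j hij
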